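/- Let $d$ be a nonnegative integer and let $\mu$ be a probability distribution on $\mathbb{R}^{d\times d}$ with compact support $\mathcal M = \operatorname{supp}\mu$. Assume that the singular part $\mu_s$ of $\mu$ with respect to Lebesgue measure on $\mathbb{R}^{d\times d}$ consists of finitely many point masses, i.e. $\mu_s=\sum_{i=1}^{n} c_i\,\delta_{M_i}$ for some $n\ge 0$, positive numbers $c_1,\dots,c_n$ and matrices $M_1,\dots,M_n$. Let $A$ be a random matrix with distribution $\mu$, let $A^{\otimes p}$ denote its $p$-th Kronecker power (a $d^p\times d^p$ matrix), let $\rho$ denote the spectral radius of a square matrix (the largest modulus of its complex eigenvalues), and, for any norm $\|\cdot\|$ on $\mathbb{R}^{d\times d}$, let $$\hat\rho(\mathcal M)=\limsup_{k\to\infty}\ \sup_{A_1,\dots,A_k\in\mathcal M}\|A_k\cdots A_1\|^{1/k}$$ be the joint spectral radius of $\mathcal M$. Then all expectations $E[A^{\otimes p}]$ exist, $\hat\rho(\mathcal M)$ is finite, and $$\hat\rho(\mathcal M)=\limsup_{p\to\infty}\ \bigl(\rho(E[A^{\otimes p}])\bigr)^{1/p}.$$ -/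

import Mathlib

open MeasureTheory Filter
open scoped ENNReal NNReal Kronecker

/-- The product `σ`-algebra on `ℝ^{d×d}`; it is the Borel `σ`-algebra. -/
instance matrixMeasurableSpace (d : ℕ) : MeasurableSpace (Matrix (Fin d) (Fin d) ℝ) :=
  inferInstanceAs (MeasurableSpace (Fin d → Fin d → ℝ))

instance matrixBorelSpace (d : ℕ) : BorelSpace (Matrix (Fin d) (Fin d) ℝ) :=
  inferInstanceAs (BorelSpace (Fin d → Fin d → ℝ))

/-- Lebesgue measure on `ℝ^{d×d}`, i.e. the product over the `d²` entries of Lebesgue measure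
on `ℝ`. It is the measure that `volume` denotes. -/
noncomputable instance matrixMeasureSpace (d : ℕ) :
    MeasureSpace (Matrix (Fin d) (Fin d) ℝ) where
  volume := (volume : Measure (Fin d → Fin d → ℝ))

/-- The Kronecker power `M^{⊗p}`, a `d^p × d^p` matrix: `M^{⊗(p+1)} = M^{⊗p} ⊗ M`, where the pairs
of indices are enumerated in lexicographic order. The power `M^{⊗0}` is the `1 × 1` identity. -/
def kronPow {d : ℕ} (M : Matrix (Fin d) (Fin d) ℝ) :
    (p : ℕ) → Matrix (Fin (d ^ p)) (Fin (d ^ p)) ℝ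
  | 0 => 1
  | p + 1 => Matrix.reindex (finProdFinEquiv.trans (finCongr (pow_succ d p).symm))
      (finProdFinEquiv.trans (finCongr (pow_succ d p).symm)) (kronPow M p ⊗ₖ M)

/-- The expectation `E[A^{⊗p}]` (taken entry by entry) for a random matrix `A` with law `μ`. -/
noncomputable def expKronPow {d : ℕ} (μ : Measure (Matrix (Fin d) (Fin d) ℝ)) (p : ℕ) :
    Matrix (Fin (d ^ p)) (Fin (d ^ p)) ℝ :=
  Matrix.of fun i j => ∫ A, kronPow A p i j ∂μ

/-- The spectral radius of a real square matrix: the largest modulus of its complex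
eigenvalues. -/
noncomputable def matrixSpectralRadius {n : ℕ} (M : Matrix (Fin n) (Fin n) ℝ) : ℝ≥0∞ :=
  spectralRadius ℂ (M.map ((↑) : ℝ → ℂ))

/-- The joint spectral radius of a set `S` of matrices, computed with the norm `N`:
`limsup_{k → ∞} sup_{A₁, …, A_k ∈ S} N(A_k ⋯ A₁)^{1/k}`, as an element of `[0, ∞]`.
(The tuple `A` lists the factors from left to right; all tuples are allowed.) -/
noncomputable def jointSpectralRadius {d : ℕ} (N : Seminorm ℝ (Matrix (Fin d) (Fin d) ℝ))
    (S : Set (Matrix (Fin d) (Fin d) ℝ)) : ℝ≥0∞ :=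
  limsup (fun k : ℕ => ⨆ (A : Fin k → Matrix (Fin d) (Fin d) ℝ) (_ : ∀ i, A i ∈ S),
    ENNReal.ofReal (N (List.ofFn A).prod) ^ (1 / (k : ℝ))) atTop

/-!
Let `A` have law `μ`, supported on `𝓜`. By independence, `E[A^{⊗p}]^k` is the expectation of
`X^{⊗p}` for a product `X` of `k` independent copies of `A`, and its trace is `E[(tr X)^p]`. The
values of `X` lie in `𝓜^k`, and letting `k → ∞` shows that `ρ(E[A^{⊗p}]) ≤ r^p` for every `r` above
the joint spectral radius.

Conversely, if `ρ(E[A^{⊗p}]) ≤ q^p` for large `p`, then the even moments of `tr X` are at most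
`(d q^k)^p`, so `|tr X| ≤ d q^k` for all `X ∈ 𝓜^k`. Traces control norms: in the algebra generated
by `𝓜`, the radical of the form `(x, y) ↦ tr (x y)` is an ideal without nonzero idempotents, hence
nilpotent. Modulo this ideal the products of length `k` are `O(q^k)`, and nilpotency lifts this
to `O(r^k)` for every `r > q`.
-/

open scoped Pointwise

section Limsup

theorem limsup_rpow_one_div_le {u : ℕ → ℝ≥0∞} {C r : ℝ≥0∞} (hC : C ≠ ∞)
    (h : ∀ᶠ n in atTop, u n ≤ C * r ^ n) :
    limsup (fun n : ℕ => u n ^ (1 / (n : ℝ))) atTop ≤ r := by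
  have hlim : Tendsto (fun n : ℕ => max C 1 ^ (1 / (n : ℝ)) * r) atTop (nhds r) := by
    have hroot : Tendsto (fun n : ℕ => max C 1 ^ (1 / (n : ℝ))) atTop (nhds 1) := by
      lift C to ℝ≥0 using hC
      have hC1 : max C 1 ≠ 0 := by positivity
      simpa only [NNReal.rpow_zero, ENNReal.coe_rpow_of_ne_zero hC1, ENNReal.coe_max,
        ENNReal.coe_one] using ENNReal.tendsto_coe.2 ((tendsto_const_nhds (x := max C 1)).nnrpow
          tendsto_one_div_atTop_nhds_zero_nat (.inl hC1))
    simpa only [one_mul] using ENNReal.Tendsto.mul_const hroot (.inl one_ne_zero)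
  refine (limsup_le_limsup ?_).trans_eq hlim.limsup_eq
  filter_upwards [h, eventually_ne_atTop 0] with n hn hn0
  calc u n ^ (1 / (n : ℝ)) ≤ (max C 1 * r ^ n) ^ (1 / (n : ℝ)) := by
        gcongr
        exact hn.trans (by gcongr; exact le_max_left _ _)
    _ = max C 1 ^ (1 / (n : ℝ)) * r := by
        rw [ENNReal.mul_rpow_of_nonneg _ _ (by positivity), one_div,
          ENNReal.pow_rpow_inv_natCast hn0]

theorem eventually_le_pow_of_limsup_rpow_one_div_lt {u : ℕ → ℝ≥0∞} {r : ℝ≥0∞}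
    (h : limsup (fun n : ℕ => u n ^ (1 / (n : ℝ))) atTop < r) :
    ∀ᶠ n in atTop, u n ≤ r ^ n := by
  filter_upwards [eventually_lt_of_limsup_lt h, eventually_gt_atTop 0] with n hn hn0
  rw [one_div, ENNReal.rpow_inv_lt_iff (by positivity), ENNReal.rpow_natCast] at hn
  exact hn.le

end Limsup

section Nilpotent

theorem exists_mul_pow_eq_of_isArtinianRing {R : Type*} [CommRing R] [IsArtinianRing R] (x : R) :
    ∃ (a : R) (n : ℕ), IsIdempotentElem (a * x) ∧ a * x * x ^ n = x ^ n := by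
  obtain ⟨n, y, hy⟩ := IsArtinian.exists_pow_succ_smul_dvd x (1 : R)
  simp only [smul_eq_mul, mul_one, Nat.succ_eq_add_one] at hy
  have hpow (m : ℕ) : y ^ m * x ^ m * x ^ n = x ^ n := by
    induction m with
    | zero => simp
    | succ m ih =>
      calc y ^ (m + 1) * x ^ (m + 1) * x ^ n = y ^ m * x ^ m * (x ^ (n + 1) * y) := by ring
        _ = x ^ n := by rw [hy, ih]
  have he : y ^ (n + 1) * x ^ n * x * x ^ n = x ^ n := by
    rw [mul_assoc _ (x ^ n), ← pow_succ, hpow]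
  refine ⟨y ^ (n + 1) * x ^ n, n, ?_, he⟩
  calc y ^ (n + 1) * x ^ n * x * (y ^ (n + 1) * x ^ n * x)
      = y ^ (n + 1) * x * (y ^ (n + 1) * x ^ n * x * x ^ n) := by ring
    _ = y ^ (n + 1) * x ^ n * x := by rw [he]; ring

open scoped IsMulCommutative in
theorem isNilpotent_of_forall_isIdempotentElem (K : Type*) {A : Type*} [Field K] [Ring A]
    [Algebra K A] [FiniteDimensional K A] {x : A}
    (hx : ∀ a, IsIdempotentElem (a * x) → a * x = 0) : IsNilpotent x := by
  have : IsArtinianRing (Algebra.adjoin K {x}) := .of_finite K _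
  obtain ⟨a, n, hidem, hpow⟩ := exists_mul_pow_eq_of_isArtinianRing
    (⟨x, Algebra.self_mem_adjoin_singleton K x⟩ : Algebra.adjoin K {x})
  have hzero : (a : A) * x = 0 := hx a (congrArg Subtype.val hidem)
  have hpow' : (a : A) * x * x ^ n = x ^ n := congrArg Subtype.val hpow
  exact ⟨n, by rw [← hpow', hzero, zero_mul]⟩

theorem le_jacobson_of_forall_isNilpotent {R : Type*} [Ring R] {I : Ideal R}
    (hI : ∀ x ∈ I, IsNilpotent x) : I ≤ Ring.jacobson R := by
  intro x hx
  rw [← Ideal.jacobson_bot, Ideal.mem_jacobson_iff]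
  intro y
  obtain ⟨u, hu⟩ := (hI _ (I.mul_mem_left y hx)).isUnit_add_one
  refine ⟨↑u⁻¹, ?_⟩
  rw [mul_assoc, ← mul_add_one, ← hu, Units.inv_mul, sub_self]
  exact zero_mem _

theorem isNilpotent_ideal_of_forall_isIdempotentElem (K : Type*) {A : Type*} [Field K] [Ring A]
    [Algebra K A] [FiniteDimensional K A] {I : Ideal A}
    (hI : ∀ e ∈ I, IsIdempotentElem e → e = 0) : IsNilpotent I := by
  have : IsArtinianRing A := .of_finite K A
  have hle : I ≤ Ring.jacobson A := le_jacobson_of_forall_isNilpotent fun x hx =>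
    isNilpotent_of_forall_isIdempotentElem K fun a => hI _ (I.mul_mem_left a hx)
  obtain ⟨n, hn⟩ := IsSemiprimaryRing.isNilpotent (R := A)
  exact ⟨n, le_bot_iff.1 ((Ideal.pow_right_mono hle n).trans hn.le)⟩

/-- The radical `{x | ∀ y, τ (x * y) = 0}` of the symmetric form `(x, y) ↦ τ (x * y)` defined by a
tracial functional `τ`. -/
def tracialRadical {K A : Type*} [CommRing K] [Ring A] [Algebra K A] (τ : A →ₗ[K] K)
    (hτ : ∀ x y, τ (x * y) = τ (y * x)) : Ideal A where
  carrier := {x | ∀ y, τ (x * y) = 0}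
  add_mem' hx hy z := by rw [add_mul, map_add, hx z, hy z, add_zero]
  zero_mem' y := by rw [zero_mul, map_zero]
  smul_mem' a x hx y := by
    rw [smul_eq_mul, mul_assoc, hτ, mul_assoc]
    exact hx _

instance isTwoSided_tracialRadical {K A : Type*} [CommRing K] [Ring A] [Algebra K A]
    (τ : A →ₗ[K] K) (hτ : ∀ x y, τ (x * y) = τ (y * x)) : (tracialRadical τ hτ).IsTwoSided :=
  ⟨fun b ha y => by rw [mul_assoc]; exact ha (b * y)⟩

end Nilpotent

section Growth

variable {A : Type*} [NormedRing A] {S : Set A} {K C L r : ℝ}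

theorem norm_le_of_mem_pow (hK : ∀ x ∈ S, ‖x‖ ≤ K) (k : ℕ) {x : A} (hx : x ∈ S ^ k) :
    ‖x‖ ≤ ‖(1 : A)‖ * K ^ k := by
  induction k generalizing x with
  | zero => simp_all
  | succ k ih =>
    rw [pow_succ] at hx
    obtain ⟨y, hy, z, hz, rfl⟩ := hx
    have hK0 : 0 ≤ K := (norm_nonneg z).trans (hK z hz)
    rw [pow_succ, ← mul_assoc]
    exact (norm_mul_le y z).trans (mul_le_mul (ih hy) (hK z hz) (norm_nonneg z) (by positivity))

-- In `u * x * y = u * y' + u * (x * y - y')` the first summand has one factor fewer in front of a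
-- representative of size `C * L ^ (j + 1)`, and the second one lies deeper in the ideal.
theorem norm_mul_mul_le_of_mul_ideal {I J : Ideal A} {G E : ℝ} (hL : 0 ≤ L) (hLr : L ≤ r)
    (hK : ∀ x ∈ S, ‖x‖ ≤ K) (hC : ∀ k, ∀ x ∈ S ^ k, ∃ y, x - y ∈ I ∧ ‖y‖ ≤ C * L ^ k)
    (hG : 0 ≤ G) (hIJ : ∀ k, ∀ x ∈ S ^ k, ∀ z ∈ I * J, ‖x * z‖ ≤ G * r ^ k * ‖z‖)
    (hCE : C ≤ E) (hE : E * L + G * (C * (K + L)) ≤ E * r) {i j : ℕ} {u v y z : A}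
    (hu : u ∈ S ^ i) (hv : v ∈ S ^ j) (hvy : v - y ∈ I) (hy : ‖y‖ ≤ C * L ^ j) (hz : z ∈ J) :
    ‖u * (y * z)‖ ≤ E * r ^ i * (L ^ j * ‖z‖) := by
  have hr : 0 ≤ r := hL.trans hLr
  induction i generalizing u j v y with
  | zero =>
    obtain rfl : u = 1 := by simpa using hu
    calc ‖1 * (y * z)‖ ≤ C * L ^ j * ‖z‖ := by
          rw [one_mul]
          exact (norm_mul_le y z).trans (by gcongr)
      _ ≤ E * L ^ j * ‖z‖ := by gcongr
      _ = E * r ^ 0 * (L ^ j * ‖z‖) := by ring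
  | succ i ih =>
    rw [pow_succ] at hu
    obtain ⟨u, hu, x, hx, rfl⟩ := hu
    have hxv : x * v ∈ S ^ (j + 1) := by
      rw [pow_succ']
      exact Set.mul_mem_mul hx hv
    obtain ⟨y', hy'I, hy'⟩ := hC (j + 1) (x * v) hxv
    have hmem : x * y - y' ∈ I := by
      convert! I.sub_mem hy'I (I.mul_mem_left x hvy) using 1
      noncomm_ring
    have hnorm : ‖x * y - y'‖ ≤ C * (K + L) * L ^ j :=
      calc ‖x * y - y'‖ ≤ ‖x‖ * ‖y‖ + ‖y'‖ := (norm_sub_le _ _).trans (by grw [norm_mul_le])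
        _ ≤ K * (C * L ^ j) + C * L ^ (j + 1) := by
          gcongr
          exacts [(norm_nonneg x).trans (hK x hx), hK x hx]
        _ = C * (K + L) * L ^ j := by ring
    calc ‖u * x * (y * z)‖ = ‖u * (y' * z) + u * ((x * y - y') * z)‖ := by congr 1; noncomm_ring
      _ ≤ ‖u * (y' * z)‖ + ‖u * ((x * y - y') * z)‖ := norm_add_le _ _
      _ ≤ E * r ^ i * (L ^ (j + 1) * ‖z‖) + G * r ^ i * (C * (K + L) * L ^ j * ‖z‖) := by
        refine add_le_add (ih hu hxv hy'I hy') ?_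
        grw [hIJ i u hu _ (Ideal.mul_mem_mul hmem hz), norm_mul_le, hnorm]
      _ = (E * L + G * (C * (K + L))) * (r ^ i * (L ^ j * ‖z‖)) := by ring
      _ ≤ E * r * (r ^ i * (L ^ j * ‖z‖)) := by gcongr
      _ = E * r ^ (i + 1) * (L ^ j * ‖z‖) := by ring

theorem exists_norm_mul_le_of_mul_ideal {I J : Ideal A} (hL : 0 ≤ L) (hLr : L < r)
    (hK : ∀ x ∈ S, ‖x‖ ≤ K) (hC : ∀ k, ∀ x ∈ S ^ k, ∃ y, x - y ∈ I ∧ ‖y‖ ≤ C * L ^ k)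
    (hIJ : ∃ G, 0 ≤ G ∧ ∀ k, ∀ x ∈ S ^ k, ∀ z ∈ I * J, ‖x * z‖ ≤ G * r ^ k * ‖z‖) :
    ∃ G, 0 ≤ G ∧ ∀ k, ∀ x ∈ S ^ k, ∀ z ∈ J, ‖x * z‖ ≤ G * r ^ k * ‖z‖ := by
  have hr : 0 ≤ r := hL.trans hLr.le
  obtain ⟨G, hG, hIJ⟩ := hIJ
  obtain ⟨y, hyI, hy⟩ := hC 0 1 (by simp)
  set E := max C (G * (C * (K + L)) / (r - L))
  have hCE : C ≤ E := le_max_left _ _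
  have hE : E * L + G * (C * (K + L)) ≤ E * r := by
    have := (div_le_iff₀ (sub_pos.2 hLr)).1 (le_max_right C (G * (C * (K + L)) / (r - L)))
    linarith
  have hE0 : 0 ≤ E := by
    rw [pow_zero, mul_one] at hy
    exact (norm_nonneg y).trans (hy.trans hCE)
  refine ⟨E + G * ‖1 - y‖, by positivity, fun k x hx z hz => ?_⟩
  calc ‖x * z‖ = ‖x * (y * z) + x * ((1 - y) * z)‖ := by congr 1; noncomm_ring
    _ ≤ ‖x * (y * z)‖ + ‖x * ((1 - y) * z)‖ := norm_add_le _ _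
    _ ≤ E * r ^ k * (L ^ 0 * ‖z‖) + G * r ^ k * (‖1 - y‖ * ‖z‖) := by
      refine add_le_add (norm_mul_mul_le_of_mul_ideal hL hLr.le hK hC hG hIJ hCE hE hx
        (v := 1) (by simp) hyI hy hz) ?_
      grw [hIJ k x hx _ (Ideal.mul_mem_mul hyI hz), norm_mul_le]
    _ = (E + G * ‖1 - y‖) * r ^ k * ‖z‖ := by ring

theorem exists_norm_le_of_isNilpotent_ideal {I : Ideal A} [I.IsTwoSided] (hI : IsNilpotent I)
    (hL : 0 ≤ L) (hLr : L < r) (hK : ∀ x ∈ S, ‖x‖ ≤ K)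
    (hC : ∀ k, ∀ x ∈ S ^ k, ∃ y, x - y ∈ I ∧ ‖y‖ ≤ C * L ^ k) :
    ∃ G, ∀ k, ∀ x ∈ S ^ k, ‖x‖ ≤ G * r ^ k := by
  obtain ⟨n, hn⟩ := hI
  have hpow (j : ℕ) (hj : j ≤ n) :
      ∃ G, 0 ≤ G ∧ ∀ k, ∀ x ∈ S ^ k, ∀ z ∈ I ^ j, ‖x * z‖ ≤ G * r ^ k * ‖z‖ := by
    induction hj using Nat.decreasingInduction with
    | self =>
      refine ⟨0, le_rfl, fun k x _ z hz => ?_⟩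
      obtain rfl : z = 0 := by simpa [hn] using hz
      simp
    | of_succ j _ ih =>
      rw [Ideal.IsTwoSided.pow_succ] at ih
      exact exists_norm_mul_le_of_mul_ideal hL hLr hK hC ih
  obtain ⟨G, -, hG⟩ := hpow 0 n.zero_le
  refine ⟨G * ‖(1 : A)‖, fun k x hx => ?_⟩
  have := hG k x hx 1 (by rw [Submodule.pow_zero, Ideal.one_eq_top]; exact Submodule.mem_top)
  rwa [mul_one, mul_right_comm] at this

end Growth

section TraceGrowth

theorem exists_mem_pow_of_mem_closure {M : Type*} [Monoid M] {S : Set M} {x : M}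
    (hx : x ∈ Submonoid.closure S) : ∃ n : ℕ, x ∈ S ^ n := by
  induction hx using Submonoid.closure_induction with
  | mem x hx => exact ⟨1, by simpa using hx⟩
  | one => exact ⟨0, by simp⟩
  | mul x y _ _ ihx ihy =>
    obtain ⟨m, hm⟩ := ihx
    obtain ⟨n, hn⟩ := ihy
    exact ⟨m + n, by rw [pow_add]; exact Set.mul_mem_mul hm hn⟩

variable {𝕜 : Type*} [NontriviallyNormedField 𝕜] [CompleteSpace 𝕜]

theorem exists_map_eq_and_norm_le {E F : Type*} [NormedAddCommGroup E] [NormedSpace 𝕜 E]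
    [FiniteDimensional 𝕜 E] [NormedAddCommGroup F] [NormedSpace 𝕜 F] (f : E →ₗ[𝕜] F) :
    ∃ C > 0, ∀ x, ∃ y, f y = f x ∧ ‖y‖ ≤ C * ‖f x‖ := by
  have := FiniteDimensional.complete 𝕜 E
  have := FiniteDimensional.complete 𝕜 (LinearMap.range f)
  obtain ⟨C, hC, h⟩ :=
    (LinearMap.toContinuousLinearMap f.rangeRestrict).exists_preimage_norm_le
      f.surjective_rangeRestrict
  refine ⟨C, hC, fun x => ?_⟩
  obtain ⟨y, hy, hyC⟩ := h (f.rangeRestrict x)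
  exact ⟨y, congrArg Subtype.val hy, hyC⟩

variable {A : Type*} [NormedRing A] [NormedAlgebra 𝕜 A] [FiniteDimensional 𝕜 A]
  {τ : A →ₗ[𝕜] 𝕜} {S : Set A} {D K L r : ℝ}

-- Modulo the radical, `x` is determined by the numbers `τ (x * b)` with `b` in a finite set of
-- products of elements of `S` that spans `A`.
theorem exists_sub_mem_tracialRadical_and_norm_le (hτ : ∀ x y, τ (x * y) = τ (y * x))
    (hS : Algebra.adjoin 𝕜 S = ⊤) (hL : 0 ≤ L) (htr : ∀ k, ∀ x ∈ S ^ k, ‖τ x‖ ≤ D * L ^ k) :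
    ∃ C, ∀ k, ∀ x ∈ S ^ k, ∃ y, x - y ∈ tracialRadical τ hτ ∧ ‖y‖ ≤ C * L ^ k := by
  have hspan : Submodule.span 𝕜 (Submonoid.closure S : Set A) = ⊤ := by
    rw [← Algebra.adjoin_eq_span, hS, Algebra.top_toSubmodule]
  obtain ⟨B, hBS, hB⟩ := (Submodule.fg_span_iff_fg_span_finset_subset _).1
    (hspan ▸ Module.Finite.fg_top)
  choose m hm using fun b : B => exists_mem_pow_of_mem_closure (hBS b.2)
  obtain ⟨M, hM⟩ := Finite.exists_le fun b : B => (D * L ^ m b).toNNReal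
  let Φ : A →ₗ[𝕜] B → 𝕜 := LinearMap.pi fun b => τ ∘ₗ LinearMap.mulRight 𝕜 (b : A)
  have hΦ_radical (x : A) (hx : Φ x = 0) : x ∈ tracialRadical τ hτ := by
    have hle : Submodule.span 𝕜 (B : Set A) ≤ LinearMap.ker (τ ∘ₗ LinearMap.mulLeft 𝕜 x) :=
      Submodule.span_le.2 fun b hb => congrFun hx ⟨b, hb⟩
    exact fun y => hle (by rw [← hB, hspan]; exact Submodule.mem_top)
  have hΦ_norm (k : ℕ) (x : A) (hx : x ∈ S ^ k) : ‖Φ x‖ ≤ M * L ^ k := by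
    refine (pi_norm_le_iff_of_nonneg (by positivity)).2 fun b => ?_
    have hxb : x * b ∈ S ^ (k + m b) := by
      rw [pow_add]
      exact Set.mul_mem_mul hx (hm b)
    calc ‖τ (x * b)‖ ≤ D * L ^ m b * L ^ k := (htr _ _ hxb).trans_eq (by ring)
      _ ≤ M * L ^ k := by
        gcongr
        exact (Real.le_coe_toNNReal _).trans (NNReal.coe_le_coe.2 (hM b))
  obtain ⟨C, hC, h⟩ := exists_map_eq_and_norm_le Φ
  refine ⟨C * M, fun k x hx => ?_⟩
  obtain ⟨y, hy, hyC⟩ := h x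
  refine ⟨y, hΦ_radical _ (by rw [map_sub, hy, sub_self]), hyC.trans ?_⟩
  rw [mul_assoc]
  gcongr
  exact hΦ_norm k x hx

theorem exists_norm_le_of_norm_trace_le_of_adjoin_eq_top (hτ : ∀ x y, τ (x * y) = τ (y * x))
    (hidem : ∀ e, IsIdempotentElem e → τ e = 0 → e = 0) (hS : Algebra.adjoin 𝕜 S = ⊤)
    (hL : 0 ≤ L) (hLr : L < r) (hK : ∀ x ∈ S, ‖x‖ ≤ K)
    (htr : ∀ k, ∀ x ∈ S ^ k, ‖τ x‖ ≤ D * L ^ k) :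
    ∃ G, ∀ k, ∀ x ∈ S ^ k, ‖x‖ ≤ G * r ^ k := by
  obtain ⟨C, hC⟩ := exists_sub_mem_tracialRadical_and_norm_le hτ hS hL htr
  refine exists_norm_le_of_isNilpotent_ideal
    (isNilpotent_ideal_of_forall_isIdempotentElem 𝕜 fun e he h => hidem e h ?_) hL hLr hK hC
  simpa using he 1

theorem exists_norm_le_of_norm_trace_le (hτ : ∀ x y, τ (x * y) = τ (y * x))
    (hidem : ∀ e, IsIdempotentElem e → τ e = 0 → e = 0) (hL : 0 ≤ L) (hLr : L < r)
    (hK : ∀ x ∈ S, ‖x‖ ≤ K) (htr : ∀ k, ∀ x ∈ S ^ k, ‖τ x‖ ≤ D * L ^ k) :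
    ∃ G, ∀ k, ∀ x ∈ S ^ k, ‖x‖ ≤ G * r ^ k := by
  let B := Algebra.adjoin 𝕜 S
  let T : Set B := (↑) ⁻¹' S
  have hT (k : ℕ) : B.val '' T ^ k = S ^ k := by
    rw [Set.image_pow]
    congr 1
    exact Set.image_preimage_eq_of_subset fun x hx => ⟨⟨x, Algebra.subset_adjoin hx⟩, rfl⟩
  obtain ⟨G, hG⟩ := exists_norm_le_of_norm_trace_le_of_adjoin_eq_top
    (τ := τ ∘ₗ B.val.toLinearMap) (S := T) (fun x y => hτ x y)
    (fun e he h => Subtype.ext (hidem e (congrArg Subtype.val he) h))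
    Algebra.adjoin_adjoin_coe_preimage hL hLr (fun x hx => hK x hx)
    (fun k x hx => htr k x (hT k ▸ Set.mem_image_of_mem B.val hx))
  refine ⟨G, fun k x hx => ?_⟩
  rw [← hT k] at hx
  obtain ⟨y, hy, rfl⟩ := hx
  exact hG k y hy

end TraceGrowth

section Seminorm

variable {E F : Type*} [NormedAddCommGroup F] [NormedSpace ℝ F]

theorem exists_seminorm_le_norm [FiniteDimensional ℝ F] (N : Seminorm ℝ F) :
    ∃ C > 0, ∀ x, N x ≤ C * ‖x‖ :=
  N.bound_of_continuous_normedSpace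
    (continuousOn_univ.1 (N.convexOn.continuousOn isOpen_univ))

theorem exists_norm_apply_le_seminorm [AddCommGroup E] [Module ℝ E] [FiniteDimensional ℝ E]
    {N : Seminorm ℝ E} (hN : ∀ x, N x = 0 → x = 0) (f : E →ₗ[ℝ] F) :
    ∃ C > 0, ∀ x, ‖f x‖ ≤ C * N x := by
  let : Norm E := ⟨N⟩
  have core : NormedSpace.Core ℝ E :=
    { norm_nonneg := apply_nonneg N
      norm_smul := map_smul_eq_mul N
      norm_triangle := map_add_le_add N
      norm_eq_zero_iff := fun x => ⟨hN x, fun h => h ▸ map_zero N⟩ }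
  let : NormedAddCommGroup E := .ofCore core
  let : NormedSpace ℝ E := .ofCore core
  exact (LinearMap.toContinuousLinearMap f).bound

theorem exists_enorm_apply_le_seminorm {n : Type*} [Finite n]
    {N : Seminorm ℝ (Matrix n n ℝ)} (hN : ∀ X, N X = 0 → X = 0) :
    ∃ C : ℝ≥0, ∀ X i j, ‖X i j‖ₑ ≤ C * ENNReal.ofReal (N X) := by
  have := Fintype.ofFinite n
  obtain ⟨C, hC, hCN⟩ :=
    exists_norm_apply_le_seminorm hN (Matrix.ofLinearEquiv ℝ).symm.toLinearMap
  refine ⟨C.toNNReal, fun X i j => ?_⟩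
  have hentry : ‖X i j‖ ≤ C * N X :=
    ((norm_le_pi_norm (X i) j).trans (norm_le_pi_norm (fun i => X i) i)).trans (hCN X)
  calc ‖X i j‖ₑ = ENNReal.ofReal ‖X i j‖ := (ofReal_norm _).symm
    _ ≤ ENNReal.ofReal (C * N X) := ENNReal.ofReal_le_ofReal hentry
    _ = C.toNNReal * ENNReal.ofReal (N X) := ENNReal.ofReal_mul hC.le

end Seminorm

section MatrixNorm

open scoped Matrix.Norms.Operator

variable {n : Type*} [Fintype n]

theorem linfty_opENorm_le_card_mul {m α : Type*} [Fintype m] [SeminormedAddCommGroup α]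
    {A : Matrix m n α} {c : ℝ≥0∞} (h : ∀ i j, ‖A i j‖ₑ ≤ c) : ‖A‖ₑ ≤ Fintype.card n * c := by
  rw [enorm_eq_nnnorm, Matrix.linfty_opNNNorm_def, ENNReal.coe_finset_sup]
  refine Finset.sup_le fun i _ => ?_
  rw [ENNReal.ofNNReal_finsetSum, ← nsmul_eq_mul]
  exact Finset.sum_le_card_nsmul _ _ c fun j _ => h i j

theorem eq_zero_of_isIdempotentElem_of_trace_eq_zero {K : Type*} [Field K] [CharZero K]
    {e : Matrix n n K} (he : IsIdempotentElem e) (h : e.trace = 0) : e = 0 := by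
  classical
  have h0 : Matrix.toLin' e = 0 :=
    (LinearMap.IsIdempotentElem.trace_eq_zero_iff (he.map Matrix.toLinAlgEquiv')).1
      ((Matrix.trace_toLin'_eq e).trans h)
  exact (LinearEquiv.map_eq_zero_iff _).1 h0

variable [DecidableEq n] {S : Set (Matrix n n ℝ)} {K : ℝ}

theorem exists_seminorm_le_of_abs_trace_le (N : Seminorm ℝ (Matrix n n ℝ)) {D L r : ℝ}
    (hL : 0 ≤ L) (hLr : L < r) (hK : ∀ X ∈ S, ‖X‖ ≤ K)
    (htr : ∀ k, ∀ X ∈ S ^ k, |X.trace| ≤ D * L ^ k) :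
    ∃ G, ∀ k, ∀ X ∈ S ^ k, N X ≤ G * r ^ k := by
  obtain ⟨C, hC, hCN⟩ := exists_seminorm_le_norm N
  obtain ⟨G, hG⟩ := exists_norm_le_of_norm_trace_le (τ := Matrix.traceLinearMap n ℝ ℝ)
    Matrix.trace_mul_comm (fun _ => eq_zero_of_isIdempotentElem_of_trace_eq_zero) hL hLr hK htr
  refine ⟨C * G, fun k X hX => (hCN X).trans ?_⟩
  rw [mul_assoc]
  gcongr
  exact hG k X hX

theorem exists_seminorm_le_of_norm_le (N : Seminorm ℝ (Matrix n n ℝ)) (hK : ∀ X ∈ S, ‖X‖ ≤ K) :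
    ∃ G, ∀ k, ∀ X ∈ S ^ k, N X ≤ G * K ^ k := by
  obtain ⟨C, hC, hCN⟩ := exists_seminorm_le_norm N
  refine ⟨C * ‖(1 : Matrix n n ℝ)‖, fun k X hX => (hCN X).trans ?_⟩
  rw [mul_assoc]
  gcongr
  exact norm_le_of_mem_pow hK k hX

end MatrixNorm

section Spectral

open scoped Matrix.Norms.Operator

theorem spectralRadius_le_of_eventually_enorm_pow_le {𝕜 A : Type*} [NormedField 𝕜] [NormedRing A]
    [NormedAlgebra 𝕜 A] [CompleteSpace A] {a : A} {C r : ℝ≥0∞} (hC : C ≠ ∞)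
    (h : ∀ᶠ k in atTop, ‖a ^ k‖ₑ ≤ C * r ^ k) : spectralRadius 𝕜 a ≤ r :=
  (spectrum.spectralRadius_le_liminf_pow_nnnorm_pow_one_div 𝕜 a).trans
    (le_trans liminf_le_limsup (limsup_rpow_one_div_le hC h))

theorem spectralRadius_pow_le_pow {𝕜 A : Type*} [NormedField 𝕜] [IsAlgClosed 𝕜] [Ring A]
    [Algebra 𝕜 A] (a : A) {k : ℕ} (hk : k ≠ 0) :
    spectralRadius 𝕜 (a ^ k) ≤ spectralRadius 𝕜 a ^ k := by
  refine iSup₂_le fun z hz => ?_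
  rw [spectrum.map_pow_of_pos _ (Nat.pos_of_ne_zero hk)] at hz
  obtain ⟨w, hw, rfl⟩ := hz
  rw [nnnorm_pow, ENNReal.coe_pow]
  gcongr
  exact le_iSup₂ (f := fun (w : 𝕜) (_ : w ∈ spectrum 𝕜 a) => (‖w‖₊ : ℝ≥0∞)) w hw

theorem enorm_trace_le_card_mul_spectralRadius {n 𝕜 : Type*} [Fintype n] [DecidableEq n]
    [NormedField 𝕜] [IsAlgClosed 𝕜] (M : Matrix n n 𝕜) :
    ‖M.trace‖ₑ ≤ Fintype.card n * spectralRadius 𝕜 M := by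
  have hroot (z : 𝕜) (hz : z ∈ M.charpoly.roots) : ‖z‖ₑ ≤ spectralRadius 𝕜 M :=
    le_iSup₂ (f := fun (w : 𝕜) (_ : w ∈ spectrum 𝕜 M) => (‖w‖₊ : ℝ≥0∞)) z
      (Matrix.mem_spectrum_of_isRoot_charpoly (Polynomial.isRoot_of_mem_roots hz))
  calc ‖M.trace‖ₑ ≤ (M.charpoly.roots.map (‖·‖ₑ)).sum := by
        rw [Matrix.trace_eq_sum_roots_charpoly]
        exact Multiset.le_sum_of_subadditive _ enorm_zero.le enorm_add_le _
    _ ≤ M.charpoly.roots.card • spectralRadius 𝕜 M := by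
        simpa only [Multiset.card_map] using Multiset.sum_le_card_nsmul _ _
          (Multiset.forall_mem_map_iff.2 hroot)
    _ ≤ Fintype.card n * spectralRadius 𝕜 M := by
        rw [nsmul_eq_mul]
        gcongr
        exact (Polynomial.card_roots' _).trans_eq M.charpoly_natDegree_eq_dim

theorem enorm_complex_ofReal (x : ℝ) : ‖(x : ℂ)‖ₑ = ‖x‖ₑ := by
  rw [← ofReal_norm, Complex.norm_real, ofReal_norm]

variable {n : ℕ} (M : Matrix (Fin n) (Fin n) ℝ)

theorem map_ofReal_pow (k : ℕ) : M.map ((↑) : ℝ → ℂ) ^ k = (M ^ k).map ((↑) : ℝ → ℂ) :=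
  (map_pow Complex.ofRealHom.mapMatrix M k).symm

theorem matrixSpectralRadius_le_of_eventually_enorm_pow_apply_le {C r : ℝ≥0∞} (hC : C ≠ ∞)
    (h : ∀ᶠ k in atTop, ∀ i j, ‖(M ^ k) i j‖ₑ ≤ C * r ^ k) : matrixSpectralRadius M ≤ r := by
  refine spectralRadius_le_of_eventually_enorm_pow_le (C := n * C) (by finiteness) ?_
  filter_upwards [h] with k hk
  rw [map_ofReal_pow, mul_assoc]
  refine (linfty_opENorm_le_card_mul (c := C * r ^ k) fun i j => ?_).trans_eq (by simp)
  rw [Matrix.map_apply, enorm_complex_ofReal]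
  exact hk i j

theorem enorm_trace_pow_le_matrixSpectralRadius_pow (k : ℕ) :
    ‖(M ^ k).trace‖ₑ ≤ n * matrixSpectralRadius M ^ k := by
  rcases eq_or_ne k 0 with rfl | hk
  · simp
  have htrace : ((M ^ k).trace : ℂ) = (M.map ((↑) : ℝ → ℂ) ^ k).trace := by
    rw [map_ofReal_pow]
    exact AddMonoidHom.map_trace Complex.ofRealHom (M ^ k)
  calc ‖(M ^ k).trace‖ₑ = ‖(M.map ((↑) : ℝ → ℂ) ^ k).trace‖ₑ := by
        rw [← htrace, enorm_complex_ofReal]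
    _ ≤ n * spectralRadius ℂ (M.map ((↑) : ℝ → ℂ) ^ k) := by
        simpa using enorm_trace_le_card_mul_spectralRadius (M.map ((↑) : ℝ → ℂ) ^ k)
    _ ≤ n * matrixSpectralRadius M ^ k := by
        gcongr
        exact spectralRadius_pow_le_pow _ hk

end Spectral

section JointSpectralRadius

variable {d : ℕ} {N : Seminorm ℝ (Matrix (Fin d) (Fin d) ℝ)} {S : Set (Matrix (Fin d) (Fin d) ℝ)}
  {r : ℝ≥0∞}

theorem jointSpectralRadius_eq_limsup :
    jointSpectralRadius N S =
      limsup (fun k : ℕ => (⨆ X ∈ S ^ k, ENNReal.ofReal (N X)) ^ (1 / (k : ℝ))) atTop := by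
  refine limsup_congr ?_
  filter_upwards [eventually_gt_atTop 0] with k hk
  refine le_antisymm (iSup₂_le fun A hA => ?_) ?_
  · gcongr
    exact le_iSup₂ (f := fun X (_ : X ∈ S ^ k) => ENNReal.ofReal (N X)) _
      (Set.mem_pow.2 ⟨fun i => ⟨A i, hA i⟩, rfl⟩)
  · rw [one_div, ENNReal.rpow_inv_le_iff (by positivity)]
    refine iSup₂_le fun X hX => ?_
    obtain ⟨A, rfl⟩ := Set.mem_pow.1 hX
    rw [← ENNReal.rpow_inv_le_iff (by positivity)]
    exact le_iSup₂ (f := fun (A : Fin k → Matrix (Fin d) (Fin d) ℝ) (_ : ∀ i, A i ∈ S) =>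
      ENNReal.ofReal (N (List.ofFn A).prod) ^ (k : ℝ)⁻¹) (fun i => (A i).1) fun i => (A i).2

theorem jointSpectralRadius_le {C : ℝ≥0∞} (hC : C ≠ ∞)
    (h : ∀ k, ∀ X ∈ S ^ k, ENNReal.ofReal (N X) ≤ C * r ^ k) : jointSpectralRadius N S ≤ r := by
  rw [jointSpectralRadius_eq_limsup]
  exact limsup_rpow_one_div_le hC (Eventually.of_forall fun k => iSup₂_le (h k))

theorem eventually_le_pow_of_jointSpectralRadius_lt (h : jointSpectralRadius N S < r) :
    ∀ᶠ k in atTop, ∀ X ∈ S ^ k, ENNReal.ofReal (N X) ≤ r ^ k := by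
  rw [jointSpectralRadius_eq_limsup] at h
  filter_upwards [eventually_le_pow_of_limsup_rpow_one_div_lt h] with k hk X hX
  exact (le_iSup₂ (f := fun X (_ : X ∈ S ^ k) => ENNReal.ofReal (N X)) X hX).trans hk

theorem jointSpectralRadius_le_coe {G : ℝ} {r : ℝ≥0}
    (h : ∀ k, ∀ X ∈ S ^ k, N X ≤ G * r ^ k) : jointSpectralRadius N S ≤ r := by
  refine jointSpectralRadius_le ENNReal.ofReal_ne_top (C := ENNReal.ofReal G) fun k X hX => ?_
  calc ENNReal.ofReal (N X) ≤ ENNReal.ofReal (G * r ^ k) := ENNReal.ofReal_le_ofReal (h k X hX)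
    _ = ENNReal.ofReal G * r ^ k := by
        rw [ENNReal.ofReal_mul' (by positivity), ENNReal.ofReal_pow r.coe_nonneg,
          ENNReal.ofReal_coe_nnreal]

open scoped Matrix.Norms.Operator in
theorem jointSpectralRadius_ne_top (N : Seminorm ℝ (Matrix (Fin d) (Fin d) ℝ))
    (hS : IsCompact S) : jointSpectralRadius N S ≠ ∞ := by
  obtain ⟨K, hK⟩ := hS.exists_bound_of_continuousOn continuousOn_id
  obtain ⟨G, hG⟩ := exists_seminorm_le_of_norm_le N (K := K.toNNReal)
    fun X hX => (hK X hX).trans (Real.le_coe_toNNReal K)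
  exact ((jointSpectralRadius_le_coe hG).trans_lt ENNReal.coe_lt_top).ne

end JointSpectralRadius

section KroneckerPower

variable {d : ℕ}

theorem kronPow_one (p : ℕ) : kronPow (1 : Matrix (Fin d) (Fin d) ℝ) p = 1 := by
  induction p with
  | zero => rfl
  | succ p ih =>
    rw [kronPow, ih, Matrix.one_kronecker_one, Matrix.reindex_apply, Matrix.submatrix_one_equiv]

theorem kronPow_mul (X Y : Matrix (Fin d) (Fin d) ℝ) (p : ℕ) :
    kronPow (X * Y) p = kronPow X p * kronPow Y p := by
  induction p with
  | zero => exact (one_mul 1).symm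
  | succ p ih =>
    simp only [kronPow, ih, Matrix.mul_kronecker_mul, Matrix.reindex_apply,
      Matrix.submatrix_mul_equiv]

theorem trace_kronPow (X : Matrix (Fin d) (Fin d) ℝ) (p : ℕ) :
    (kronPow X p).trace = X.trace ^ p := by
  induction p with
  | zero =>
    rw [kronPow, pow_zero]
    exact (Matrix.trace_one (n := Fin 1)).trans (by simp)
  | succ p ih =>
    rw [pow_succ X.trace, ← ih, ← Matrix.trace_kronecker, kronPow, Matrix.reindex_apply]
    exact Equiv.sum_comp _ (fun i => (kronPow X p ⊗ₖ X) i i)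

theorem enorm_kronPow_apply_le {X : Matrix (Fin d) (Fin d) ℝ} {c : ℝ≥0∞}
    (hX : ∀ i j, ‖X i j‖ₑ ≤ c) (p : ℕ) (i j : Fin (d ^ p)) : ‖kronPow X p i j‖ₑ ≤ c ^ p := by
  induction p with
  | zero =>
    rw [kronPow, Subsingleton.elim (α := Fin 1) i j, Matrix.one_apply_eq, enorm_one, pow_zero]
  | succ p ih =>
    rw [kronPow, Matrix.reindex_apply, Matrix.submatrix_apply, Matrix.kronecker_apply, enorm_mul,
      pow_succ c]
    exact mul_le_mul' (ih _ _) (hX _ _)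

theorem continuous_kronPow (p : ℕ) :
    Continuous fun X : Matrix (Fin d) (Fin d) ℝ => kronPow X p := by
  induction p with
  | zero => exact continuous_const
  | succ p ih =>
    refine continuous_matrix fun i j => ?_
    simp only [kronPow, Matrix.reindex_apply, Matrix.submatrix_apply]
    exact (ih.matrix_elem _ _).mul (continuous_id.matrix_elem _ _)

end KroneckerPower

section Support

theorem isCompact_pow {M : Type*} [Monoid M] [TopologicalSpace M] [ContinuousMul M] {s : Set M}
    (hs : IsCompact s) (n : ℕ) : IsCompact (s ^ n) := by
  induction n with
  | zero => exact (pow_zero s).symm ▸ isCompact_singleton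
  | succ n ih => exact pow_succ s n ▸ ih.mul hs

variable {X E : Type*} [TopologicalSpace X] [MeasurableSpace X] [OpensMeasurableSpace X]

theorem support_dirac [T1Space X] (x : X) : (Measure.dirac x).support = {x} := by
  refine (Measure.support_subset_of_isClosed isClosed_singleton ?_).antisymm ?_
  · rw [ae_dirac_eq]
    exact Set.mem_singleton x
  · refine Set.singleton_subset_iff.2 ((Measure.mem_support_iff_forall x).2 fun U hU => ?_)
    rw [Measure.dirac_apply_of_mem (mem_of_mem_nhds hU)]
    exact one_pos

theorem integrable_of_isCompact_support [HereditarilyLindelofSpace X] [NormedAddCommGroup E]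
    {μ : Measure X} [IsFiniteMeasureOnCompacts μ] (hμ : IsCompact μ.support) {f : X → E}
    (hf : Continuous f) : Integrable f μ := by
  rw [← Measure.restrict_eq_self_of_ae_mem (Measure.support_mem_ae (μ := μ))]
  exact hf.continuousOn.integrableOn_compact' hμ Measure.isClosed_support.measurableSet

end Support

section Convolution

variable {M : Type*} [Monoid M] [MeasurableSpace M]

/-- The `n`-th multiplicative convolution power of a measure: for a probability measure, the law
of a product of `n` independent factors. The power `0` is the Dirac mass at `1`. -/
noncomputable def mconvPow (μ : Measure M) : ℕ → Measure M
  | 0 => Measure.dirac 1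
  | n + 1 => mconvPow μ n ∗ₘ μ

variable [MeasurableMul₂ M]

theorem mconv_univ (μ ν : Measure M) [SFinite ν] :
    (μ ∗ₘ ν) Set.univ = μ Set.univ * ν Set.univ := by
  rw [Measure.mconv, Measure.map_apply measurable_mul MeasurableSet.univ, Set.preimage_univ,
    ← Set.univ_prod_univ, Measure.prod_prod]

theorem mconvPow_univ (μ : Measure M) [SFinite μ] (n : ℕ) :
    mconvPow μ n Set.univ = μ Set.univ ^ n := by
  induction n with
  | zero => rw [mconvPow, measure_univ, pow_zero]
  | succ n ih => rw [mconvPow, mconv_univ, ih, pow_succ]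

instance isFiniteMeasure_mconvPow (μ : Measure M) [IsFiniteMeasure μ] (n : ℕ) :
    IsFiniteMeasure (mconvPow μ n) :=
  ⟨by rw [mconvPow_univ]; finiteness⟩

variable [TopologicalSpace M] [ContinuousMul M]

theorem support_mul_support_subset_support_mconv (μ ν : Measure M) [SFinite ν] :
    μ.support * ν.support ⊆ (μ ∗ₘ ν).support := by
  rintro _ ⟨x, hx, y, hy, rfl⟩
  refine (Measure.mem_support_iff_forall _).2 fun U hU => ?_
  obtain ⟨V, hV, W, hW, hVW⟩ := mem_nhds_prod_iff.1 (continuous_mul.continuousAt (x := (x, y)) hU)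
  calc 0 < μ V * ν W := ENNReal.mul_pos ((Measure.mem_support_iff_forall x).1 hx V hV).ne'
        ((Measure.mem_support_iff_forall y).1 hy W hW).ne'
    _ = μ.prod ν (V ×ˢ W) := (Measure.prod_prod V W).symm
    _ ≤ μ.prod ν ((fun z => z.1 * z.2) ⁻¹' U) := measure_mono hVW
    _ ≤ (μ ∗ₘ ν) U := Measure.le_map_apply measurable_mul.aemeasurable U

variable [OpensMeasurableSpace M] [HereditarilyLindelofSpace M] [T2Space M]

theorem support_mconv {μ ν : Measure M} [SFinite ν] (hμ : IsCompact μ.support)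
    (hν : IsCompact ν.support) : (μ ∗ₘ ν).support = μ.support * ν.support := by
  have hclosed : IsClosed (μ.support * ν.support) := (hμ.mul hν).isClosed
  refine (Measure.support_subset_of_isClosed hclosed ?_).antisymm
    (support_mul_support_subset_support_mconv μ ν)
  refine (ae_map_iff measurable_mul.aemeasurable hclosed.measurableSet).2 ?_
  filter_upwards [Measure.quasiMeasurePreserving_fst.ae Measure.support_mem_ae,
    Measure.quasiMeasurePreserving_snd.ae Measure.support_mem_ae] with z hz₁ hz₂
  exact Set.mul_mem_mul hz₁ hz₂

theorem support_mconvPow {μ : Measure M} [SFinite μ] (hμ : IsCompact μ.support) (n : ℕ) :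
    (mconvPow μ n).support = μ.support ^ n := by
  induction n with
  | zero => rw [mconvPow, support_dirac, pow_zero, Set.singleton_one]
  | succ n ih => rw [mconvPow, support_mconv (ih ▸ isCompact_pow hμ n) hμ, ih, pow_succ]

end Convolution

section Expectation

variable {d : ℕ} {μ ν : Measure (Matrix (Fin d) (Fin d) ℝ)}

instance matrixSecondCountableTopology (d : ℕ) :
    SecondCountableTopology (Matrix (Fin d) (Fin d) ℝ) :=
  inferInstanceAs (SecondCountableTopology (Fin d → Fin d → ℝ))

theorem enorm_expKronPow_apply_le {c : ℝ≥0∞} (hc : ∀ X ∈ μ.support, ∀ i j, ‖X i j‖ₑ ≤ c) (p : ℕ)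
    (i j : Fin (d ^ p)) : ‖expKronPow μ p i j‖ₑ ≤ c ^ p * μ Set.univ := by
  calc ‖expKronPow μ p i j‖ₑ ≤ ∫⁻ X, ‖kronPow X p i j‖ₑ ∂μ := enorm_integral_le_lintegral_enorm _
    _ ≤ ∫⁻ _, c ^ p ∂μ := by
        refine lintegral_mono_ae ?_
        filter_upwards [Measure.support_mem_ae] with X hX
        exact enorm_kronPow_apply_le (hc X hX) p i j
    _ = c ^ p * μ Set.univ := lintegral_const _

variable [IsFiniteMeasure μ] [IsFiniteMeasure ν]

theorem integrable_kronPow_apply (hμ : IsCompact μ.support) (p : ℕ) (i j : Fin (d ^ p)) :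
    Integrable (fun X => kronPow X p i j) μ :=
  integrable_of_isCompact_support hμ ((continuous_kronPow p).matrix_elem i j)

theorem expKronPow_dirac_one (p : ℕ) :
    expKronPow (Measure.dirac (1 : Matrix (Fin d) (Fin d) ℝ)) p = 1 := by
  ext i j
  rw [expKronPow, Matrix.of_apply, integral_dirac, kronPow_one]

theorem expKronPow_mconv (hμ : IsCompact μ.support) (hν : IsCompact ν.support) (p : ℕ) :
    expKronPow (μ ∗ₘ ν) p = expKronPow μ p * expKronPow ν p := by
  ext i j
  have hμν : IsCompact (μ ∗ₘ ν).support := support_mconv hμ hν ▸ hμ.mul hν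
  have hX (l) := integrable_kronPow_apply hμ p i l
  have hY (l) := integrable_kronPow_apply hν p l j
  simp only [expKronPow, Matrix.mul_apply, Matrix.of_apply]
  rw [integral_mconv (integrable_kronPow_apply hμν p i j)]
  simp only [kronPow_mul, Matrix.mul_apply]
  calc ∫ X, ∫ Y, ∑ l, kronPow X p i l * kronPow Y p l j ∂ν ∂μ
      = ∫ X, ∑ l, kronPow X p i l * ∫ Y, kronPow Y p l j ∂ν ∂μ := by
        congr with X
        rw [integral_finsetSum _ fun l _ => (hY l).const_mul _]
        simp only [integral_const_mul]
    _ = ∑ l, (∫ X, kronPow X p i l ∂μ) * ∫ Y, kronPow Y p l j ∂ν := by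
        rw [integral_finsetSum _ fun l _ => (hX l).mul_const _]
        simp only [integral_mul_const]

theorem expKronPow_mconvPow (hμ : IsCompact μ.support) (p k : ℕ) :
    expKronPow (mconvPow μ k) p = expKronPow μ p ^ k := by
  induction k with
  | zero => exact expKronPow_dirac_one p
  | succ k ih =>
    have hk : IsCompact (mconvPow μ k).support := support_mconvPow hμ k ▸ isCompact_pow hμ k
    rw [mconvPow, expKronPow_mconv hk hμ, ih, pow_succ]

theorem integral_trace_pow (hμ : IsCompact μ.support) (p : ℕ) :
    ∫ X, X.trace ^ p ∂μ = (expKronPow μ p).trace := by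
  simp only [← trace_kronPow]
  exact integral_finsetSum _ fun i _ => integrable_kronPow_apply hμ p i i

end Expectation

section Moments

theorem le_of_mem_support_of_frequently_lintegral_pow_le {X : Type*} [TopologicalSpace X]
    [MeasurableSpace X] [OpensMeasurableSpace X] {μ : Measure X} {f : X → ℝ≥0∞}
    (hf : Continuous f) {c : ℝ≥0∞} (h : ∃ᶠ p in atTop, ∫⁻ x, f x ^ p ∂μ ≤ c ^ p) {x : X}
    (hx : x ∈ μ.support) : f x ≤ c := by
  by_contra! hcx
  obtain ⟨t, hct, htx⟩ := exists_between hcx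
  have ht : t ≠ 0 := (bot_le.trans_lt hct).ne'
  have ht' : t ≠ ∞ := (htx.trans_le le_top).ne
  have hpos : 0 < μ {y | t ≤ f y} := (Measure.mem_support_iff_forall x).1 hx _
    (mem_of_superset ((isOpen_lt continuous_const hf).mem_nhds htx)
      (Set.ofPred_subset_ofPred.2 fun _ => le_of_lt))
  have hlt : c / t < 1 := ENNReal.div_lt_of_lt_mul (by rwa [one_mul])
  obtain ⟨p, hp, hpt⟩ := (h.and_eventually
    ((ENNReal.tendsto_pow_atTop_nhds_zero_of_lt_one hlt).eventually_lt_const hpos)).exists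
  refine hpt.not_ge ?_
  rw [div_eq_mul_inv, mul_pow, ← ENNReal.inv_pow, ← div_eq_mul_inv,
    ENNReal.le_div_iff_mul_le (.inl (pow_ne_zero p ht)) (.inl (by finiteness)), mul_comm]
  calc t ^ p * μ {y | t ≤ f y} ≤ t ^ p * μ {y | t ^ p ≤ f y ^ p} := by
        refine mul_le_mul_right (measure_mono fun y (hy : t ≤ f y) => ?_) _
        exact pow_le_pow_left' hy p
    _ ≤ ∫⁻ x, f x ^ p ∂μ := mul_meas_ge_le_lintegral (hf.measurable.pow_const p) _
    _ ≤ c ^ p := hp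

variable {d : ℕ} {μ : Measure (Matrix (Fin d) (Fin d) ℝ)} [IsFiniteMeasure μ]

theorem lintegral_enorm_trace_pow_le (hμ : IsCompact μ.support) {p : ℕ} (hp : Even p) (k : ℕ) :
    ∫⁻ X, ‖X.trace‖ₑ ^ p ∂mconvPow μ k ≤ d ^ p * matrixSpectralRadius (expKronPow μ p) ^ k := by
  have hk : IsCompact (mconvPow μ k).support := support_mconvPow hμ k ▸ isCompact_pow hμ k
  have hint : Integrable (fun X => X.trace ^ p) (mconvPow μ k) :=
    integrable_of_isCompact_support hk (continuous_id.matrix_trace.pow p)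
  calc ∫⁻ X, ‖X.trace‖ₑ ^ p ∂mconvPow μ k = ∫⁻ X, ENNReal.ofReal (X.trace ^ p) ∂mconvPow μ k := by
        simp only [← enorm_pow, Real.enorm_of_nonneg (hp.pow_nonneg _)]
    _ = ENNReal.ofReal (∫ X, X.trace ^ p ∂mconvPow μ k) :=
        (ofReal_integral_eq_lintegral_ofReal hint
          (Eventually.of_forall fun X => hp.pow_nonneg _)).symm
    _ ≤ ‖(expKronPow μ p ^ k).trace‖ₑ := by
        rw [integral_trace_pow hk, expKronPow_mconvPow hμ]
        exact Real.ofReal_le_enorm _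
    _ ≤ d ^ p * matrixSpectralRadius (expKronPow μ p) ^ k := by
        rw [← Nat.cast_pow]
        exact enorm_trace_pow_le_matrixSpectralRadius_pow _ k

theorem enorm_trace_le_of_mem_support_pow (hμ : IsCompact μ.support) {q : ℝ≥0∞}
    (h : ∀ᶠ p in atTop, matrixSpectralRadius (expKronPow μ p) ≤ q ^ p) {k : ℕ}
    {X : Matrix (Fin d) (Fin d) ℝ} (hX : X ∈ μ.support ^ k) : ‖X.trace‖ₑ ≤ d * q ^ k := by
  rw [← support_mconvPow hμ] at hX
  refine le_of_mem_support_of_frequently_lintegral_pow_le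
    (f := fun X : Matrix (Fin d) (Fin d) ℝ => ‖X.trace‖ₑ) (by fun_prop) ?_ hX
  have heven : ∃ᶠ p : ℕ in atTop, Even p :=
    frequently_atTop.2 fun a => ⟨2 * a, by lia, even_two_mul a⟩
  refine (heven.and_eventually h).mono fun p ⟨hp, hρ⟩ => ?_
  calc ∫⁻ X, ‖X.trace‖ₑ ^ p ∂mconvPow μ k
      ≤ d ^ p * matrixSpectralRadius (expKronPow μ p) ^ k := lintegral_enorm_trace_pow_le hμ hp k
    _ ≤ d ^ p * (q ^ p) ^ k := by gcongr
    _ = (d * q ^ k) ^ p := by rw [mul_pow, pow_right_comm]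

end Moments

section Main

variable {d : ℕ} {μ : Measure (Matrix (Fin d) (Fin d) ℝ)} [IsFiniteMeasure μ]

open scoped Matrix.Norms.Operator in
theorem jointSpectralRadius_le_limsup (N : Seminorm ℝ (Matrix (Fin d) (Fin d) ℝ))
    (hμ : IsCompact μ.support) :
    jointSpectralRadius N μ.support ≤
      limsup (fun p : ℕ => matrixSpectralRadius (expKronPow μ p) ^ (1 / (p : ℝ))) atTop := by
  refine le_of_forall_gt_imp_ge_of_dense fun a ha => ?_
  obtain ⟨q, hρq, hqa⟩ := ENNReal.lt_iff_exists_nnreal_btwn.1 ha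
  obtain ⟨r, hqr, hra⟩ := ENNReal.lt_iff_exists_nnreal_btwn.1 hqa
  have htr (k : ℕ) (X : Matrix (Fin d) (Fin d) ℝ) (hX : X ∈ μ.support ^ k) :
      |X.trace| ≤ d * (q : ℝ) ^ k := by
    have := enorm_trace_le_of_mem_support_pow hμ
      (eventually_le_pow_of_limsup_rpow_one_div_lt hρq) hX
    exact_mod_cast this
  obtain ⟨K, hK⟩ := hμ.exists_bound_of_continuousOn continuousOn_id
  obtain ⟨G, hG⟩ := exists_seminorm_le_of_abs_trace_le N q.coe_nonneg (by exact_mod_cast hqr) hK htr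
  exact (jointSpectralRadius_le_coe hG).trans hra.le

variable {N : Seminorm ℝ (Matrix (Fin d) (Fin d) ℝ)}

theorem matrixSpectralRadius_expKronPow_le (hμ : IsCompact μ.support)
    (hN : ∀ A, N A = 0 → A = 0) {r : ℝ≥0∞} (h : jointSpectralRadius N μ.support < r) (p : ℕ) :
    matrixSpectralRadius (expKronPow μ p) ≤ μ Set.univ * r ^ p := by
  obtain ⟨C, hC⟩ := exists_enorm_apply_le_seminorm hN
  refine matrixSpectralRadius_le_of_eventually_enorm_pow_apply_le (C := C ^ p) _ (by finiteness) ?_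
  filter_upwards [eventually_le_pow_of_jointSpectralRadius_lt h] with k hk i j
  have hentry (X) (hX : X ∈ (mconvPow μ k).support) (i j) : ‖X i j‖ₑ ≤ C * r ^ k := by
    rw [support_mconvPow hμ] at hX
    exact (hC X i j).trans (by gcongr; exact hk X hX)
  calc ‖(expKronPow μ p ^ k) i j‖ₑ ≤ (C * r ^ k) ^ p * mconvPow μ k Set.univ := by
        rw [← expKronPow_mconvPow hμ]
        exact enorm_expKronPow_apply_le hentry p i j
    _ = C ^ p * (μ Set.univ * r ^ p) ^ k := by
        rw [mconvPow_univ, mul_pow, mul_pow, pow_right_comm, mul_assoc, mul_comm ((r ^ p) ^ k)]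

theorem limsup_le_jointSpectralRadius (hμ : IsCompact μ.support) (hN : ∀ A, N A = 0 → A = 0) :
    limsup (fun p : ℕ => matrixSpectralRadius (expKronPow μ p) ^ (1 / (p : ℝ))) atTop ≤
      jointSpectralRadius N μ.support :=
  le_of_forall_gt_imp_ge_of_dense fun _ hr => limsup_rpow_one_div_le (measure_ne_top μ Set.univ)
    (Eventually.of_forall (matrixSpectralRadius_expKronPow_le hμ hN hr))

end Main

theorem theorem3_general (d : ℕ) (μ : Measure (Matrix (Fin d) (Fin d) ℝ)) [IsFiniteMeasure μ]
    (hsupp : IsCompact μ.support)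
    (N : Seminorm ℝ (Matrix (Fin d) (Fin d) ℝ)) (hN : ∀ A, N A = 0 → A = 0) :
    (∀ (p : ℕ) (i j : Fin (d ^ p)), Integrable (fun A => kronPow A p i j) μ) ∧
    jointSpectralRadius N μ.support ≠ ∞ ∧
    jointSpectralRadius N μ.support =
      limsup (fun p : ℕ => matrixSpectralRadius (expKronPow μ p) ^ (1 / (p : ℝ))) atTop :=
  ⟨integrable_kronPow_apply hsupp, jointSpectralRadius_ne_top N hsupp,
    (jointSpectralRadius_le_limsup N hsupp).antisymm (limsup_le_jointSpectralRadius hsupp hN)⟩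

theorem theorem3 (d : ℕ) (μ : Measure (Matrix (Fin d) (Fin d) ℝ)) [IsProbabilityMeasure μ]
    (hsupp : IsCompact μ.support)
    (hsing : ∃ (n : ℕ) (c : Fin n → ℝ≥0) (M : Fin n → Matrix (Fin d) (Fin d) ℝ),
      (∀ i, 0 < c i) ∧ μ.singularPart volume = ∑ i, c i • Measure.dirac (M i))
    (N : Seminorm ℝ (Matrix (Fin d) (Fin d) ℝ)) (hN : ∀ A, N A = 0 → A = 0) :
    (∀ (p : ℕ) (i j : Fin (d ^ p)), Integrable (fun A => kronPow A p i j) μ) ∧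
    jointSpectralRadius N μ.support ≠ ∞ ∧
    jointSpectralRadius N μ.support =
      limsup (fun p : ℕ => matrixSpectralRadius (expKronPow μ p) ^ (1 / (p : ℝ))) atTop :=
  theorem3_general d μ hsupp N hN
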